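/- For real numbers $\epsilon,\epsilon'$, a complex number $\zeta$ and $\tau$ in the upper half plane, let $$\theta\left[\begin{array}{c}\epsilon\\ \epsilon'\end{array}\right](\zeta,\tau)=\sum_{n\in\mathbb{Z}}\exp\left(2\pi i\left[\frac12\left(n+\frac{\epsilon}{2}\right)^2\tau+\left(n+\frac{\epsilon}{2}\right)\left(\zeta+\frac{\epsilon'}{2}\right)\right]\right),$$ and let $\theta'\left[\begin{array}{c}\epsilon\\ \epsilon'\end{array}\right](0,\tau)$ denote its derivative $\frac{\partial}{\partial\zeta}\theta\left[\begin{array}{c}\epsilon\\ \epsilon'\end{array}\right](\zeta,\tau)\Big|_{\zeta=0}$. Then for every $\tau\in\mathbb{C}$ with $\operatorname{Im}\tau>0$, $$\theta'\left[\begin{array}{c}1\\ \frac14\end{array}\right](0,\tau)=-\pi\,\theta\left[\begin{array}{c}1\\ \frac14\end{array}\right](0,\tau)\,\theta\left[\begin{array}{c}0\\ 0\end{array}\right](0,4\tau)\left\{\sqrt2\,\theta\left[\begin{array}{c}0\\ 0\end{array}\right](0,2\tau)-\theta\left[\begin{array}{c}0\\ 0\end{array}\right](0,4\tau)\right\}$$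 and $$\theta'\left[\begin{array}{c}1\\ \frac34\end{array}\right](0,\tau)=-\pi\,\theta\left[\begin{array}{c}1\\ \frac34\end{array}\right](0,\tau)\,\theta\left[\begin{array}{c}0\\ 0\end{array}\right](0,4\tau)\left\{\sqrt2\,\theta\left[\begin{array}{c}0\\ 0\end{array}\right](0,2\tau)+\theta\left[\begin{array}{c}0\\ 0\end{array}\right](0,4\tau)\right\}.$$ -/

import Mathlib

/-- The theta function with characteristic `[ε; ε']`,
`θ[ε; ε'](ζ, τ) = ∑_{n ∈ ℤ} exp (2πi [(1/2)(n + ε/2)² τ + (n + ε/2)(ζ + ε'/2)])`,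
for `τ` in the upper half plane. -/
noncomputable def theta (ε ε' : ℝ) (ζ τ : ℂ) : ℂ :=
  ∑' n : ℤ, Complex.exp (2 * (Real.pi : ℂ) * Complex.I *
    ((1 / 2 : ℂ) * ((n : ℂ) + (ε : ℂ) / 2) ^ 2 * τ
      + ((n : ℂ) + (ε : ℂ) / 2) * (ζ + (ε' : ℂ) / 2)))

/-- The series defining `theta` converges for every `ζ` and every `τ` in the upper half plane,
so `theta` is the value of a genuine sum there. -/
theorem hasSum_theta (ε ε' : ℝ) (ζ : ℂ) {τ : ℂ} (hτ : 0 < τ.im) :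
    HasSum (fun n : ℤ => Complex.exp (2 * (Real.pi : ℂ) * Complex.I *
      ((1 / 2 : ℂ) * ((n : ℂ) + (ε : ℂ) / 2) ^ 2 * τ
        + ((n : ℂ) + (ε : ℂ) / 2) * (ζ + (ε' : ℂ) / 2)))) (theta ε ε' ζ τ) := by
  have h := ((hasSum_jacobiTheta₂_term (ζ + (ε' : ℂ) / 2 + (ε : ℂ) / 2 * τ) hτ).mul_left
    (Complex.exp (2 * (Real.pi : ℂ) * Complex.I *
      ((1 / 2 : ℂ) * ((ε : ℂ) / 2) ^ 2 * τ + (ε : ℂ) / 2 * (ζ + (ε' : ℂ) / 2))))).summable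
  refine (h.congr fun n => ?_).hasSum
  rw [jacobiTheta₂_term, ← Complex.exp_add]
  congr 1
  ring

/-! Translating `ζ` by `ε'/2` turns the two claims into formulas for the derivative of θ₂ at 1/8 and
3/8. The doubling formula `thetaTwoDeriv_mul_thetaTwo` applies to this pair because 1/8 + 3/8 = 1/2,
where θ₂ and θ₃' vanish. Two terms survive, containing θ₂'(1/2, 2τ) and θ₂'(±1/4, 2τ). Jacobi's
formula `thetaTwoDeriv_half` evaluates the first and `thetaTwoDeriv_quarter` the second;
`thetaTwo_zero_mul_thetaThree_quarter` brings in √2. Oddness of θ₂' accounts for the opposite signs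
in the braces.

Jacobi's formula and the √2 identity need neither products nor modularity: by the doubling formulas
a suitable quotient is invariant under τ ↦ 2τ, hence equals its limit as Im τ → ∞. Nonvanishing of
the denominators comes from the same iteration, since a zero would propagate to every 2ⁿτ. -/

open Complex Filter Topology Set

/-! ### Rearranging series, and iterating τ ↦ 2τ towards the cusp. -/

section Series

/-- Split a double series over `ℤ × ℤ` according to the parity of the sum of the indices. -/
theorem hasSum_int_prod_of_parity {h : ℤ × ℤ → ℂ} {A B : ℂ}
    (hA : HasSum (fun p : ℤ × ℤ => h (p.1 + p.2, p.1 - p.2)) A)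
    (hB : HasSum (fun p : ℤ × ℤ => h (p.1 + p.2 + 1, p.1 - p.2)) B) : HasSum h (A + B) := by
  have i₁ : Function.Injective fun p : ℤ × ℤ => (p.1 + p.2, p.1 - p.2) := by
    rintro ⟨a, b⟩ ⟨c, d⟩ hp
    simp only [Prod.mk.injEq] at hp ⊢
    omega
  have i₂ : Function.Injective fun p : ℤ × ℤ => (p.1 + p.2 + 1, p.1 - p.2) := by
    rintro ⟨a, b⟩ ⟨c, d⟩ hp
    simp only [Prod.mk.injEq] at hp ⊢
    omega
  refine (i₁.hasSum_range_iff.2 hA).add_isCompl ?_ (i₂.hasSum_range_iff.2 hB)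
  constructor
  · rw [Set.disjoint_left]
    rintro _ ⟨⟨a, b⟩, rfl⟩ ⟨⟨c, d⟩, hp⟩
    simp only [Prod.mk.injEq] at hp
    omega
  · rw [codisjoint_iff_le_sup]
    rintro ⟨m, n⟩ -
    rcases Int.even_or_odd' (m - n) with ⟨k, hk | hk⟩
    · refine Or.inl ⟨(n + k, k), ?_⟩
      simp only [Prod.mk.injEq]
      omega
    · refine Or.inr ⟨(n + k, k), ?_⟩
      simp only [Prod.mk.injEq]
      omega

theorem hasSum_int_of_parity {h : ℤ → ℂ} {A B : ℂ}
    (hA : HasSum (fun n : ℤ => h (2 * n)) A) (hB : HasSum (fun n : ℤ => h (2 * n + 1)) B) :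
    HasSum h (A + B) := by
  have i₁ : Function.Injective fun n : ℤ => 2 * n := fun a b hp => by simp only at hp; omega
  have i₂ : Function.Injective fun n : ℤ => 2 * n + 1 := fun a b hp => by simp only at hp; omega
  refine (i₁.hasSum_range_iff.2 hA).add_isCompl ?_ (i₂.hasSum_range_iff.2 hB)
  constructor
  · rw [Set.disjoint_left]
    rintro _ ⟨a, rfl⟩ ⟨c, hp⟩
    simp only at hp
    omega
  · rw [codisjoint_iff_le_sup]
    rintro m -
    rcases Int.even_or_odd' m with ⟨k, hk | hk⟩
    · exact Or.inl ⟨k, hk.symm⟩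
    · exact Or.inr ⟨k, hk.symm⟩

theorem HasSum.mul_complex {f g : ℤ → ℂ} {a b : ℂ} (hf : HasSum f a) (hg : HasSum g b) :
    HasSum (fun p : ℤ × ℤ => f p.1 * g p.2) (a * b) :=
  hf.mul hg (summable_mul_of_summable_norm hf.summable.norm hg.summable.norm)

/-- Only the terms with exponent zero survive in the limit `im τ → ∞` of a power series in
`exp (π i τ)`. -/
theorem tendsto_tsum_exp_mul_comap_im_atTop {w : ℤ → ℤ} {c : ℤ → ℂ} (hw : ∀ n, 0 ≤ w n)
    (hs : Summable fun n => c n * cexp (Real.pi * I * w n * I)) :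
    Tendsto (fun τ : ℂ => ∑' n, c n * cexp (Real.pi * I * w n * τ)) (comap im atTop)
      (𝓝 (∑' n, if w n = 0 then c n else 0)) := by
  have nrm (n : ℤ) (τ : ℂ) :
      ‖c n * cexp (Real.pi * I * w n * τ)‖ = ‖c n‖ * Real.exp (-(Real.pi * w n * τ.im)) := by
    rw [norm_mul, Complex.norm_exp]
    congr 2
    simp
  refine tendsto_tsum_of_dominated_convergence hs.norm (fun n => ?_) ?_
  · split_ifs with h
    · simp only [h, Int.cast_zero, mul_zero, zero_mul, Complex.exp_zero, mul_one]
      exact tendsto_const_nhds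
    · have hpos : 0 < Real.pi * w n := mul_pos Real.pi_pos (by
        exact_mod_cast lt_of_le_of_ne (hw n) (Ne.symm h))
      rw [tendsto_zero_iff_norm_tendsto_zero]
      simp_rw [nrm]
      have : Tendsto (fun τ : ℂ => Real.pi * w n * τ.im) (comap im atTop) atTop :=
        tendsto_comap.const_mul_atTop hpos
      simpa using (Real.tendsto_exp_neg_atTop_nhds_zero.comp this).const_mul ‖c n‖
  -- For Im τ ≥ 1 the terms at τ = i dominate.
  · filter_upwards [tendsto_comap.eventually (eventually_ge_atTop (1 : ℝ))] with τ hτ n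
    rw [nrm, nrm]
    have : (0 : ℝ) ≤ Real.pi * w n := mul_nonneg Real.pi_pos.le (by exact_mod_cast hw n)
    gcongr
    simpa using hτ

theorem tendsto_ofReal_mul_comap_im_atTop {r : ℝ} (hr : 0 < r) :
    Tendsto (fun τ : ℂ => (r : ℂ) * τ) (comap im atTop) (comap im atTop) := by
  rw [tendsto_comap_iff]
  refine (tendsto_comap.const_mul_atTop hr).congr fun τ => ?_
  simp

theorem im_two_pow_mul (n : ℕ) (τ : ℂ) : ((2 : ℂ) ^ n * τ).im = 2 ^ n * τ.im := by
  have := im_ofReal_mul ((2 : ℝ) ^ n) τ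
  push_cast at this
  exact this

theorem tendsto_two_pow_mul_comap_im_atTop {τ : ℂ} (hτ : 0 < τ.im) :
    Tendsto (fun n : ℕ => (2 : ℂ) ^ n * τ) atTop (comap im atTop) := by
  rw [tendsto_comap_iff]
  refine ((tendsto_pow_atTop_atTop_of_one_lt (one_lt_two (α := ℝ))).atTop_mul_const hτ).congr ?_
  exact fun n => (im_two_pow_mul n τ).symm

/-- A property of `τ` that passes from `τ` to `2 τ` and fails near the cusp fails everywhere. -/
theorem not_of_two_mul_of_eventually_not {p : ℂ → Prop}
    (hp : ∀ τ : ℂ, 0 < τ.im → p τ → p (2 * τ)) (hc : ∀ᶠ τ in comap im atTop, ¬ p τ)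
    {τ : ℂ} (hτ : 0 < τ.im) : ¬ p τ := by
  intro h
  have hn (n : ℕ) : p (2 ^ n * τ) := by
    induction n with
    | zero => simpa using h
    | succ n ih =>
      rw [pow_succ', mul_assoc]
      exact hp _ (by rw [im_two_pow_mul]; positivity) ih
  obtain ⟨n, h⟩ := ((tendsto_two_pow_mul_comap_im_atTop hτ).eventually hc).exists
  exact h (hn n)

/-- A function of `τ` invariant under `τ ↦ 2 τ` equals its limit at the cusp. -/
theorem eq_of_two_mul_invariant_of_tendsto {h : ℂ → ℂ} {c : ℂ}
    (hh : ∀ τ : ℂ, 0 < τ.im → h τ = h (2 * τ)) (hc : Tendsto h (comap im atTop) (𝓝 c))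
    {τ : ℂ} (hτ : 0 < τ.im) : h τ = c := by
  have hn (n : ℕ) : h (2 ^ n * τ) = h τ := by
    induction n with
    | zero => simp
    | succ n ih => rw [pow_succ', mul_assoc, ← hh _ (by rw [im_two_pow_mul]; positivity), ih]
  refine tendsto_nhds_unique ?_ (hc.comp (tendsto_two_pow_mul_comap_im_atTop hτ))
  exact tendsto_const_nhds.congr fun n => (hn n).symm

end Series

/-! ### Symmetries, doubling formulas and derivatives of θ₂ and θ₃. -/

/-- The theta function `θ₂(z, τ) = ∑ exp (πi (n + 1/2)² τ + 2πi (n + 1/2) z)`. -/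
noncomputable def thetaTwo (z τ : ℂ) : ℂ := theta 1 0 z τ

/-- The theta function `θ₃(z, τ) = ∑ exp (πi n² τ + 2πi n z)`. -/
noncomputable def thetaThree (z τ : ℂ) : ℂ := theta 0 0 z τ

/-- The derivative of `θ₂` in its first variable. -/
noncomputable def thetaTwoDeriv (z τ : ℂ) : ℂ := deriv (fun w => thetaTwo w τ) z

theorem hasSum_thetaTwo (z : ℂ) {τ : ℂ} (hτ : 0 < τ.im) :
    HasSum (fun n : ℤ => cexp (Real.pi * I * ((n + 1 / 2) ^ 2 * τ + 2 * (n + 1 / 2) * z)))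
      (thetaTwo z τ) := by
  refine (hasSum_theta 1 0 z hτ).congr_fun ?_
  intro n
  push_cast
  ring_nf

theorem hasSum_thetaThree (z : ℂ) {τ : ℂ} (hτ : 0 < τ.im) :
    HasSum (fun n : ℤ => cexp (Real.pi * I * (n ^ 2 * τ + 2 * n * z))) (thetaThree z τ) := by
  refine (hasSum_theta 0 0 z hτ).congr_fun ?_
  intro n
  push_cast
  ring_nf

theorem thetaTwo_neg (z τ : ℂ) : thetaTwo (-z) τ = thetaTwo z τ := by
  unfold thetaTwo theta
  -- The reflection n ↦ -1 - n changes the sign of n + 1/2.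
  rw [← (Equiv.subLeft (-1 : ℤ)).tsum_eq]
  refine tsum_congr fun n => ?_
  simp only [Equiv.subLeft_apply]
  congr 1
  push_cast
  ring

theorem thetaThree_neg (z τ : ℂ) : thetaThree (-z) τ = thetaThree z τ := by
  unfold thetaThree theta
  rw [← (Equiv.neg ℤ).tsum_eq]
  refine tsum_congr fun n => ?_
  simp only [Equiv.neg_apply]
  congr 1
  push_cast
  ring

theorem thetaTwo_add_one (z τ : ℂ) : thetaTwo (z + 1) τ = -thetaTwo z τ := by
  unfold thetaTwo theta
  rw [← tsum_neg]
  refine tsum_congr fun n => ?_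
  rw [neg_eq_neg_one_mul, ← exp_pi_mul_I, ← Complex.exp_add]
  refine Complex.exp_eq_exp_iff_exists_int.2 ⟨n, ?_⟩
  push_cast
  ring

theorem thetaThree_add_one (z τ : ℂ) : thetaThree (z + 1) τ = thetaThree z τ := by
  unfold thetaThree theta
  refine tsum_congr fun n => ?_
  refine Complex.exp_eq_exp_iff_exists_int.2 ⟨n, ?_⟩
  push_cast
  ring

theorem thetaTwo_half (τ : ℂ) : thetaTwo (1 / 2) τ = 0 := by
  have h := thetaTwo_add_one (-(1 / 2)) τ
  rw [thetaTwo_neg, show -(1 / 2 : ℂ) + 1 = 1 / 2 by norm_num] at h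
  exact self_eq_neg.1 h

/-- The doubling formula for a product of two values of `θ₂`. -/
theorem thetaTwo_mul_thetaTwo (x y : ℂ) {τ : ℂ} (hτ : 0 < τ.im) :
    thetaTwo x τ * thetaTwo y τ =
      thetaTwo (x + y) (2 * τ) * thetaThree (x - y) (2 * τ) +
        thetaThree (x + y) (2 * τ) * thetaTwo (x - y) (2 * τ) := by
  have h2 : 0 < (2 * τ).im := by simpa using hτ
  refine ((hasSum_thetaTwo x hτ).mul_complex (hasSum_thetaTwo y hτ)).unique
    (hasSum_int_prod_of_parity ?_ ?_)
  · refine ((hasSum_thetaTwo (x + y) h2).mul_complex (hasSum_thetaThree (x - y) h2)).congr_fun ?_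
    rintro ⟨a, b⟩
    simp only [← Complex.exp_add]
    congr 1
    push_cast
    ring
  -- Half the sum of (a + b + 1) + 1/2 and (a - b) + 1/2 is a + 1, so the θ₃ series is shifted by
  -- one.
  · have := (Equiv.addRight (1 : ℤ)).hasSum_iff.2 (hasSum_thetaThree (x + y) h2)
    refine (this.mul_complex (hasSum_thetaTwo (x - y) h2)).congr_fun ?_
    rintro ⟨a, b⟩
    simp only [← Complex.exp_add, Function.comp_apply, Equiv.coe_addRight]
    congr 1
    push_cast
    ring

/-- The doubling formula for a product of two values of `θ₃`. -/
theorem thetaThree_mul_thetaThree (x y : ℂ) {τ : ℂ} (hτ : 0 < τ.im) :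
    thetaThree x τ * thetaThree y τ =
      thetaThree (x + y) (2 * τ) * thetaThree (x - y) (2 * τ) +
        thetaTwo (x + y) (2 * τ) * thetaTwo (x - y) (2 * τ) := by
  have h2 : 0 < (2 * τ).im := by simpa using hτ
  refine ((hasSum_thetaThree x hτ).mul_complex (hasSum_thetaThree y hτ)).unique
    (hasSum_int_prod_of_parity ?_ ?_)
  · refine ((hasSum_thetaThree (x + y) h2).mul_complex
      (hasSum_thetaThree (x - y) h2)).congr_fun ?_
    rintro ⟨a, b⟩
    simp only [← Complex.exp_add]
    congr 1
    push_cast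
    ring
  · refine ((hasSum_thetaTwo (x + y) h2).mul_complex (hasSum_thetaTwo (x - y) h2)).congr_fun ?_
    rintro ⟨a, b⟩
    simp only [← Complex.exp_add]
    congr 1
    push_cast
    ring

/-- Splitting the series of `θ₃` into its even and odd terms. -/
theorem thetaThree_eq_add (z : ℂ) {τ : ℂ} (hτ : 0 < τ.im) :
    thetaThree z τ = thetaThree (2 * z) (4 * τ) + thetaTwo (2 * z) (4 * τ) := by
  have h4 : 0 < (4 * τ).im := by simpa using hτ
  refine (hasSum_thetaThree z hτ).unique (hasSum_int_of_parity ?_ ?_)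
  · refine (hasSum_thetaThree (2 * z) h4).congr_fun fun n => ?_
    congr 1
    push_cast
    ring
  · refine (hasSum_thetaTwo (2 * z) h4).congr_fun fun n => ?_
    congr 1
    push_cast
    ring

/-- Up to an exponential factor, θ₂ is `jacobiTheta₂` translated by τ/2, so the product rule gives
both the derivative and its series. -/
theorem hasDerivAt_and_hasSum_thetaTwo (z : ℂ) {τ : ℂ} (hτ : 0 < τ.im) :
    HasDerivAt (fun w => thetaTwo w τ) (thetaTwoDeriv z τ) z ∧
    HasSum (fun n : ℤ => 2 * Real.pi * I * (n + 1 / 2) *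
      cexp (Real.pi * I * ((n + 1 / 2) ^ 2 * τ + 2 * (n + 1 / 2) * z))) (thetaTwoDeriv z τ) := by
  have key (w : ℂ) : thetaTwo w τ =
      cexp (Real.pi * I * (τ / 4 + w)) * jacobiTheta₂ (w + τ / 2) τ := by
    refine (hasSum_thetaTwo w hτ).unique
      (((hasSum_jacobiTheta₂_term (w + τ / 2) hτ).mul_left _).congr_fun fun n => ?_)
    rw [jacobiTheta₂_term, ← Complex.exp_add]
    congr 1
    ring
  have hJ := (hasDerivAt_jacobiTheta₂_fst (z + τ / 2) hτ).comp_add_const z (τ / 2)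
  have hE : HasDerivAt (fun w : ℂ => cexp (Real.pi * I * (τ / 4 + w)))
      (cexp (Real.pi * I * (τ / 4 + z)) * (Real.pi * I)) z := by
    simpa using (((hasDerivAt_id z).const_add (τ / 4)).const_mul (Real.pi * I)).cexp
  have hD := hE.mul hJ
  have hf : (fun w => thetaTwo w τ) =
      (fun w : ℂ => cexp (Real.pi * I * (τ / 4 + w))) * fun w => jacobiTheta₂ (w + τ / 2) τ :=
    funext key
  rw [← hf] at hD
  have hd : thetaTwoDeriv z τ = _ := hD.deriv
  refine ⟨hd ▸ hD, ?_⟩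
  rw [hd]
  refine (((hasSum_jacobiTheta₂_term (z + τ / 2) hτ).mul_left _).add
    ((hasSum_jacobiTheta₂'_term (z + τ / 2) hτ).mul_left _)).congr_fun fun n => ?_
  have he : cexp (Real.pi * I * ((n + 1 / 2) ^ 2 * τ + 2 * (n + 1 / 2) * z)) =
      cexp (Real.pi * I * (τ / 4 + z)) * jacobiTheta₂_term n (z + τ / 2) τ := by
    rw [jacobiTheta₂_term, ← Complex.exp_add]
    congr 1
    ring
  rw [he, jacobiTheta₂'_term]
  ring

/-- The derivative of `θ₃` in its first variable. -/
noncomputable def thetaThreeDeriv (z τ : ℂ) : ℂ := deriv (fun w => thetaThree w τ) z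

theorem hasDerivAt_thetaTwo (z : ℂ) {τ : ℂ} (hτ : 0 < τ.im) :
    HasDerivAt (fun w => thetaTwo w τ) (thetaTwoDeriv z τ) z :=
  (hasDerivAt_and_hasSum_thetaTwo z hτ).1

theorem hasDerivAt_thetaThree (z : ℂ) {τ : ℂ} (hτ : 0 < τ.im) :
    HasDerivAt (fun w => thetaThree w τ) (thetaThreeDeriv z τ) z := by
  have key : (fun w => thetaThree w τ) = fun w => jacobiTheta₂ w τ := by
    funext w
    refine (hasSum_thetaThree w hτ).unique
      ((hasSum_jacobiTheta₂_term w hτ).congr_fun fun n => ?_)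
    rw [jacobiTheta₂_term]
    congr 1
    ring
  rw [thetaThreeDeriv, key]
  exact (differentiableAt_jacobiTheta₂_fst z hτ).hasDerivAt

theorem thetaTwoDeriv_neg (z τ : ℂ) : thetaTwoDeriv (-z) τ = -thetaTwoDeriv z τ := by
  have h := deriv_comp_neg (fun w => thetaTwo w τ) z
  simp only [thetaTwo_neg] at h
  rw [thetaTwoDeriv, thetaTwoDeriv, h, neg_neg]

theorem thetaTwoDeriv_zero (τ : ℂ) : thetaTwoDeriv 0 τ = 0 := by
  have h := thetaTwoDeriv_neg 0 τ
  rw [neg_zero] at h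
  exact self_eq_neg.1 h

theorem thetaThreeDeriv_zero (τ : ℂ) : thetaThreeDeriv 0 τ = 0 := by
  have h := deriv_comp_neg (fun w => thetaThree w τ) 0
  simp only [thetaThree_neg, neg_zero] at h
  exact self_eq_neg.1 h

theorem thetaThreeDeriv_half (τ : ℂ) : thetaThreeDeriv (1 / 2) τ = 0 := by
  have h := deriv_comp_const_sub (f := fun w => thetaThree w τ) 1 (1 / 2)
  have hs (w : ℂ) : thetaThree (1 - w) τ = thetaThree w τ := by
    rw [sub_eq_neg_add, thetaThree_add_one, thetaThree_neg]
  simp only [hs, show (1 : ℂ) - 1 / 2 = 1 / 2 by norm_num] at h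
  exact self_eq_neg.1 h

/-- The derivative of the doubling formula for `θ₂(x) θ₂(y)` in `x`. -/
theorem thetaTwoDeriv_mul_thetaTwo (x y : ℂ) {τ : ℂ} (hτ : 0 < τ.im) :
    thetaTwoDeriv x τ * thetaTwo y τ =
      thetaTwoDeriv (x + y) (2 * τ) * thetaThree (x - y) (2 * τ) +
        thetaTwo (x + y) (2 * τ) * thetaThreeDeriv (x - y) (2 * τ) +
        (thetaThreeDeriv (x + y) (2 * τ) * thetaTwo (x - y) (2 * τ) +
          thetaThree (x + y) (2 * τ) * thetaTwoDeriv (x - y) (2 * τ)) := by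
  have h2 : 0 < (2 * τ).im := by simpa using hτ
  have hl := (hasDerivAt_thetaTwo x hτ).mul_const (thetaTwo y τ)
  simp only [thetaTwo_mul_thetaTwo _ _ hτ] at hl
  refine hl.unique (HasDerivAt.add (HasDerivAt.mul ?_ ?_) (HasDerivAt.mul ?_ ?_))
  · exact (hasDerivAt_thetaTwo (x + y) h2).comp_add_const x y
  · exact (hasDerivAt_thetaThree (x - y) h2).comp_sub_const x y
  · exact (hasDerivAt_thetaThree (x + y) h2).comp_add_const x y
  · exact (hasDerivAt_thetaTwo (x - y) h2).comp_sub_const x y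

/-! ### Limits as Im τ → ∞. -/

section Cusp

theorem eventually_im_pos : ∀ᶠ τ : ℂ in comap im atTop, 0 < τ.im :=
  tendsto_comap.eventually (eventually_gt_atTop 0)

theorem tendsto_thetaThree (z : ℂ) :
    Tendsto (fun τ => thetaThree z τ) (comap im atTop) (𝓝 1) := by
  have hs {τ : ℂ} (hτ : 0 < τ.im) : HasSum (fun n : ℤ => cexp (2 * Real.pi * I * n * z) *
      cexp (Real.pi * I * ((n ^ 2 : ℤ) : ℂ) * τ)) (thetaThree z τ) := by
    refine (hasSum_thetaThree z hτ).congr_fun fun n => ?_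
    rw [← Complex.exp_add]
    congr 1
    push_cast
    ring
  have h := tendsto_tsum_exp_mul_comap_im_atTop (fun n => sq_nonneg n)
    (hs (τ := I) (by simp)).summable
  rw [tsum_eq_single 0 (by intro n hn; simp [hn])] at h
  simp only [ne_eq, OfNat.ofNat_ne_zero, not_false_eq_true, zero_pow, if_true, Int.cast_zero,
    mul_zero, zero_mul, Complex.exp_zero] at h
  refine h.congr' ?_
  filter_upwards [eventually_im_pos] with τ hτ
  exact (hs hτ).tsum_eq

theorem tsum_ite_mul_add_one_eq_zero (c : ℤ → ℂ) :
    (∑' n, if n * (n + 1) = 0 then c n else 0) = c 0 + c (-1) := by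
  rw [tsum_eq_sum (s := {0, -1})]
  · rw [Finset.sum_pair (by norm_num)]
    simp
  · intro n hn
    simp only [Finset.mem_insert, Finset.mem_singleton, not_or] at hn
    refine if_neg ?_
    rw [mul_eq_zero]
    omega

theorem int_mul_add_one_nonneg (n : ℤ) : 0 ≤ n * (n + 1) := by
  rcases le_or_gt 0 n with h | h <;> nlinarith

/-- Since (n + 1/2)² = n(n + 1) + 1/4, the prefactor leaves nonnegative exponents, which vanish only
for n = 0 and n = -1. -/
theorem tendsto_exp_mul_thetaTwo (z : ℂ) :
    Tendsto (fun τ => cexp (-(Real.pi * I * τ / 4)) * thetaTwo z τ) (comap im atTop)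
      (𝓝 (2 * Complex.cos (Real.pi * z))) := by
  have hs {τ : ℂ} (hτ : 0 < τ.im) : HasSum (fun n : ℤ =>
      cexp (2 * Real.pi * I * (n + 1 / 2) * z) *
        cexp (Real.pi * I * ((n * (n + 1) : ℤ) : ℂ) * τ))
      (cexp (-(Real.pi * I * τ / 4)) * thetaTwo z τ) := by
    refine ((hasSum_thetaTwo z hτ).mul_left _).congr_fun fun n => ?_
    rw [← Complex.exp_add, ← Complex.exp_add]
    congr 1
    push_cast
    ring
  have h := tendsto_tsum_exp_mul_comap_im_atTop int_mul_add_one_nonneg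
    (hs (τ := I) (by simp)).summable
  rw [tsum_ite_mul_add_one_eq_zero] at h
  have hc : cexp (2 * Real.pi * I * (((0 : ℤ) : ℂ) + 1 / 2) * z) +
      cexp (2 * Real.pi * I * (((-1 : ℤ) : ℂ) + 1 / 2) * z) = 2 * Complex.cos (Real.pi * z) := by
    rw [Complex.two_cos]
    push_cast
    congr 2 <;> ring
  rw [hc] at h
  refine h.congr' ?_
  filter_upwards [eventually_im_pos] with τ hτ
  exact (hs hτ).tsum_eq

theorem tendsto_exp_mul_thetaTwoDeriv_half :
    Tendsto (fun τ => cexp (-(Real.pi * I * τ / 4)) * thetaTwoDeriv (1 / 2) τ) (comap im atTop)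
      (𝓝 (-(2 * Real.pi))) := by
  have hs {τ : ℂ} (hτ : 0 < τ.im) : HasSum (fun n : ℤ =>
      2 * Real.pi * I * (n + 1 / 2) * cexp (2 * Real.pi * I * (n + 1 / 2) * (1 / 2)) *
        cexp (Real.pi * I * ((n * (n + 1) : ℤ) : ℂ) * τ))
      (cexp (-(Real.pi * I * τ / 4)) * thetaTwoDeriv (1 / 2) τ) := by
    refine ((hasDerivAt_and_hasSum_thetaTwo (1 / 2) hτ).2.mul_left _).congr_fun fun n => ?_
    rw [mul_left_comm, mul_assoc, ← Complex.exp_add, ← Complex.exp_add]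
    congr 2
    push_cast
    ring
  have h := tendsto_tsum_exp_mul_comap_im_atTop int_mul_add_one_nonneg
    (hs (τ := I) (by simp)).summable
  rw [tsum_ite_mul_add_one_eq_zero] at h
  have e₁ : cexp (2 * Real.pi * I * (((0 : ℤ) : ℂ) + 1 / 2) * (1 / 2)) = I := by
    refine (congrArg cexp ?_).trans Complex.exp_pi_div_two_mul_I
    push_cast
    ring
  have e₂ : cexp (2 * Real.pi * I * (((-1 : ℤ) : ℂ) + 1 / 2) * (1 / 2)) = -I := by
    refine (congrArg cexp ?_).trans Complex.exp_neg_pi_div_two_mul_I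
    push_cast
    ring
  have hc : 2 * Real.pi * I * (((0 : ℤ) : ℂ) + 1 / 2) * I +
      2 * Real.pi * I * (((-1 : ℤ) : ℂ) + 1 / 2) * -I = -(2 * Real.pi) := by
    push_cast
    linear_combination (2 * Real.pi : ℂ) * I_mul_I
  rw [e₁, e₂, hc] at h
  refine h.congr' ?_
  filter_upwards [eventually_im_pos] with τ hτ
  exact (hs hτ).tsum_eq

end Cusp

/-! ### Values and derivatives at rational points. -/

section Nullwerte

variable {τ : ℂ}

theorem im_two_mul_pos (hτ : 0 < τ.im) : 0 < (2 * τ).im := by simpa using hτ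

theorem thetaThree_zero_mul_thetaThree_half (hτ : 0 < τ.im) :
    thetaThree 0 τ * thetaThree (1 / 2) τ = thetaThree (1 / 2) (2 * τ) ^ 2 := by
  rw [thetaThree_mul_thetaThree _ _ hτ, zero_add, zero_sub, thetaThree_neg, thetaTwo_neg,
    thetaTwo_half]
  ring

theorem thetaTwo_zero_sq (hτ : 0 < τ.im) :
    thetaTwo 0 τ ^ 2 = 2 * thetaTwo 0 (2 * τ) * thetaThree 0 (2 * τ) := by
  rw [sq, thetaTwo_mul_thetaTwo _ _ hτ, add_zero, sub_zero]
  ring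

theorem thetaThree_half_ne_zero (hτ : 0 < τ.im) : thetaThree (1 / 2) τ ≠ 0 := by
  refine not_of_two_mul_of_eventually_not (p := fun τ => thetaThree (1 / 2) τ = 0)
    (fun τ hτ h => ?_) ((tendsto_thetaThree _).eventually_ne one_ne_zero) hτ
  have := thetaThree_zero_mul_thetaThree_half hτ
  rw [h, mul_zero] at this
  exact pow_eq_zero_iff two_ne_zero |>.1 this.symm

theorem thetaThree_zero_ne_zero (hτ : 0 < τ.im) : thetaThree 0 τ ≠ 0 := by
  have h := thetaThree_zero_mul_thetaThree_half hτ
  exact left_ne_zero_of_mul (h ▸ pow_ne_zero 2 (thetaThree_half_ne_zero (im_two_mul_pos hτ)))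

theorem thetaTwo_zero_ne_zero (hτ : 0 < τ.im) : thetaTwo 0 τ ≠ 0 := by
  refine not_of_two_mul_of_eventually_not (p := fun τ => thetaTwo 0 τ = 0)
    (fun τ hτ h => ?_) ?_ hτ
  · have := thetaTwo_zero_sq hτ
    rw [h] at this
    have h3 := thetaThree_zero_ne_zero (im_two_mul_pos hτ)
    simpa [h3] using this
  · have := (tendsto_exp_mul_thetaTwo 0).eventually_ne (b₂ := 0) (by simp)
    exact this.mono fun τ h => right_ne_zero_of_mul h

/-- Jacobi's derivative formula. -/
theorem thetaTwoDeriv_half (hτ : 0 < τ.im) :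
    thetaTwoDeriv (1 / 2) τ =
      -Real.pi * (thetaTwo 0 τ * thetaThree 0 τ * thetaThree (1 / 2) τ) := by
  have key := eq_of_two_mul_invariant_of_tendsto (c := -Real.pi) (h := fun τ =>
    thetaTwoDeriv (1 / 2) τ / (thetaTwo 0 τ * thetaThree 0 τ * thetaThree (1 / 2) τ)) ?_ ?_ hτ
  · rwa [div_eq_iff (mul_ne_zero (mul_ne_zero (thetaTwo_zero_ne_zero hτ)
      (thetaThree_zero_ne_zero hτ)) (thetaThree_half_ne_zero hτ))] at key
  · intro τ hτ
    have hτ' := im_two_mul_pos hτ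
    have a := thetaTwo_zero_ne_zero hτ
    rw [div_eq_div_iff (mul_ne_zero (mul_ne_zero a
      (thetaThree_zero_ne_zero hτ)) (thetaThree_half_ne_zero hτ))
      (mul_ne_zero (mul_ne_zero (thetaTwo_zero_ne_zero hτ')
      (thetaThree_zero_ne_zero hτ')) (thetaThree_half_ne_zero hτ'))]
    -- At (1/2, 0) this reads θ₂'(1/2, τ) θ₂(0, τ) = 2 θ₂'(1/2, 2τ) θ₃(1/2, 2τ).
    have h₁ := thetaTwoDeriv_mul_thetaTwo (1 / 2) 0 hτ
    rw [add_zero, sub_zero, thetaThreeDeriv_half, thetaTwo_half] at h₁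
    have h₂ := thetaTwo_zero_sq hτ
    have h₃ := thetaThree_zero_mul_thetaThree_half hτ
    apply mul_right_cancel₀ a
    linear_combination (thetaTwo 0 (2 * τ) * thetaThree 0 (2 * τ) *
      thetaThree (1 / 2) (2 * τ)) * h₁ - thetaTwoDeriv (1 / 2) (2 * τ) *
        thetaThree 0 τ * thetaThree (1 / 2) τ * h₂ - 2 * thetaTwo 0 (2 * τ) *
        thetaThree 0 (2 * τ) * thetaTwoDeriv (1 / 2) (2 * τ) * h₃
  -- Numerator and denominator are both scaled by exp(-πiτ/4), which cancels in the quotient.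
  · have h := tendsto_exp_mul_thetaTwoDeriv_half.div (((tendsto_exp_mul_thetaTwo 0).mul
      (tendsto_thetaThree 0)).mul (tendsto_thetaThree (1 / 2))) (by simp)
    have hc : -(2 * (Real.pi : ℂ)) / (2 * Complex.cos (Real.pi * 0) * 1 * 1) = -Real.pi := by
      simp only [mul_zero, Complex.cos_zero]
      ring
    rw [hc] at h
    refine h.congr fun τ => ?_
    simp only [Pi.div_apply, mul_assoc]
    exact mul_div_mul_left _ _ (Complex.exp_ne_zero _)

theorem thetaTwo_quarter_sq (hτ : 0 < τ.im) :
    thetaTwo (1 / 4) τ ^ 2 = thetaThree (1 / 2) (2 * τ) * thetaTwo 0 (2 * τ) := by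
  rw [sq, thetaTwo_mul_thetaTwo _ _ hτ, sub_self, show (1 / 4 + 1 / 4 : ℂ) = 1 / 2 by norm_num,
    thetaTwo_half]
  ring

theorem thetaTwo_quarter_ne_zero (hτ : 0 < τ.im) : thetaTwo (1 / 4) τ ≠ 0 := by
  have hτ' := im_two_mul_pos hτ
  refine (pow_ne_zero_iff two_ne_zero).1 ?_
  rw [thetaTwo_quarter_sq hτ]
  exact mul_ne_zero (thetaThree_half_ne_zero hτ') (thetaTwo_zero_ne_zero hτ')

theorem thetaTwoDeriv_quarter (hτ : 0 < τ.im) :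
    thetaTwoDeriv (1 / 4) τ = -Real.pi * thetaTwo (1 / 4) τ * thetaThree 0 (2 * τ) ^ 2 := by
  have h₁ := thetaTwoDeriv_mul_thetaTwo (1 / 4) (1 / 4) hτ
  rw [sub_self, show (1 / 4 + 1 / 4 : ℂ) = 1 / 2 by norm_num, thetaTwo_half, thetaThreeDeriv_half,
    thetaTwoDeriv_zero, thetaTwoDeriv_half (im_two_mul_pos hτ)] at h₁
  apply mul_right_cancel₀ (thetaTwo_quarter_ne_zero hτ)
  linear_combination h₁ + Real.pi * thetaThree 0 (2 * τ) ^ 2 * thetaTwo_quarter_sq hτ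

theorem thetaThree_quarter (hτ : 0 < τ.im) :
    thetaThree (1 / 4) τ = thetaThree (1 / 2) (4 * τ) := by
  rw [thetaThree_eq_add _ hτ, show (2 * (1 / 4) : ℂ) = 1 / 2 by norm_num, thetaTwo_half, add_zero]

theorem thetaTwo_zero_mul_thetaThree_quarter (hτ : 0 < τ.im) :
    thetaTwo 0 τ * thetaThree (1 / 4) τ =
      Real.sqrt 2 * (thetaThree 0 (2 * τ) * thetaTwo (1 / 4) τ) := by
  have key := eq_of_two_mul_invariant_of_tendsto (c := Real.sqrt 2) (h := fun τ =>
    thetaTwo 0 τ * thetaThree (1 / 4) τ / (thetaThree 0 (2 * τ) * thetaTwo (1 / 4) τ)) ?_ ?_ hτ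
  · rwa [div_eq_iff (mul_ne_zero (thetaThree_zero_ne_zero (im_two_mul_pos hτ))
      (thetaTwo_quarter_ne_zero hτ))] at key
  · intro τ hτ
    have h2 := im_two_mul_pos hτ
    have h4 := im_two_mul_pos h2
    have hb := thetaTwo_quarter_ne_zero hτ
    rw [div_eq_div_iff (mul_ne_zero (thetaThree_zero_ne_zero h2) hb)
      (mul_ne_zero (thetaThree_zero_ne_zero h4) (thetaTwo_quarter_ne_zero h2))]
    have h₁ := thetaTwo_mul_thetaTwo 0 (1 / 4) hτ
    rw [zero_add, zero_sub, thetaThree_neg, thetaTwo_neg] at h₁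
    have h₂ := thetaThree_quarter hτ
    rw [show 4 * τ = 2 * (2 * τ) by ring] at h₂
    have h₃ := thetaTwo_quarter_sq hτ
    have h₄ := thetaTwo_quarter_sq h2
    have h₅ := thetaTwo_zero_sq h2
    have h₆ := thetaThree_zero_mul_thetaThree_half h2
    rw [h₂]
    apply mul_right_cancel₀ hb
    -- With the theta values as free variables, only polynomial algebra modulo the relations above
    -- remains.
    generalize thetaThree (1 / 4) (2 * τ) = u at *
    generalize thetaThree 0 (2 * (2 * τ)) = K at *
    generalize thetaThree (1 / 2) (2 * (2 * τ)) = H at *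
    generalize thetaTwo 0 (2 * (2 * τ)) = l at *
    generalize thetaTwo (1 / 4) (2 * τ) = F at *
    generalize thetaTwo 0 (2 * τ) = f at *
    generalize thetaThree 0 (2 * τ) = G at *
    linear_combination H * K * F * h₁ + 2 * u * H * K * h₄ - f * u * G * h₃ -
      f ^ 2 * u * h₆ - u * H ^ 2 * h₅
  · have hG : Tendsto (fun τ : ℂ => thetaThree 0 (2 * τ)) (comap im atTop) (𝓝 1) := by
      simpa [Function.comp_def] using
        (tendsto_thetaThree 0).comp (tendsto_ofReal_mul_comap_im_atTop (r := 2) two_pos)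
    have hcos : 2 * Complex.cos (Real.pi * (1 / 4)) = (Real.sqrt 2 : ℂ) := by
      rw [show (Real.pi * (1 / 4) : ℂ) = ((Real.pi / 4 : ℝ) : ℂ) by push_cast; ring,
        ← Complex.ofReal_cos, Real.cos_pi_div_four]
      push_cast
      ring
    have hsq : (Real.sqrt 2 : ℂ) * Real.sqrt 2 = 2 := by
      rw [← Complex.ofReal_mul, Real.mul_self_sqrt zero_le_two]
      norm_num
    have hs0 : (Real.sqrt 2 : ℂ) ≠ 0 := fun h => by simp [h] at hsq
    have h := ((tendsto_exp_mul_thetaTwo 0).mul (tendsto_thetaThree (1 / 4))).div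
      (hG.mul (tendsto_exp_mul_thetaTwo (1 / 4))) (by rw [hcos, one_mul]; exact hs0)
    have hc : 2 * Complex.cos (Real.pi * 0) * 1 / (1 * (2 * Complex.cos (Real.pi * (1 / 4)))) =
        (Real.sqrt 2 : ℂ) := by
      rw [hcos, one_mul, mul_zero, Complex.cos_zero, div_eq_iff hs0, hsq]
      norm_num
    rw [hc] at h
    refine h.congr fun τ => ?_
    simp only [Pi.div_apply]
    rw [mul_assoc, mul_left_comm (thetaThree 0 (2 * τ))]
    exact mul_div_mul_left _ _ (Complex.exp_ne_zero _)

/-- This both evaluates the factor common to the two derivative formulas and shows that θ₂ vanishes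
at neither point. -/
theorem thetaTwo_three_eighths_mul_thetaTwo_eighth (hτ : 0 < τ.im) :
    thetaTwo (3 / 8) τ * thetaTwo (1 / 8) τ =
      thetaThree (1 / 2) (2 * τ) * thetaTwo (1 / 4) (2 * τ) := by
  rw [thetaTwo_mul_thetaTwo _ _ hτ, show (3 / 8 + 1 / 8 : ℂ) = 1 / 2 by norm_num,
    show (3 / 8 - 1 / 8 : ℂ) = 1 / 4 by norm_num, thetaTwo_half]
  ring

theorem thetaTwo_three_eighths_mul_thetaTwo_eighth_ne_zero (hτ : 0 < τ.im) :
    thetaTwo (3 / 8) τ * thetaTwo (1 / 8) τ ≠ 0 := by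
  rw [thetaTwo_three_eighths_mul_thetaTwo_eighth hτ]
  exact mul_ne_zero (thetaThree_half_ne_zero (im_two_mul_pos hτ))
    (thetaTwo_quarter_ne_zero (im_two_mul_pos hτ))

theorem thetaTwoDeriv_three_eighths (hτ : 0 < τ.im) :
    thetaTwoDeriv (3 / 8) τ = -Real.pi * thetaTwo (3 / 8) τ * thetaThree 0 (4 * τ) *
      (Real.sqrt 2 * thetaThree 0 (2 * τ) + thetaThree 0 (4 * τ)) := by
  have h2 := im_two_mul_pos hτ
  have h := thetaTwoDeriv_mul_thetaTwo (3 / 8) (1 / 8) hτ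
  rw [show (3 / 8 + 1 / 8 : ℂ) = 1 / 2 by norm_num, show (3 / 8 - 1 / 8 : ℂ) = 1 / 4 by norm_num,
    thetaTwo_half, thetaThreeDeriv_half, thetaTwoDeriv_half h2, thetaTwoDeriv_quarter h2] at h
  have hp := thetaTwo_three_eighths_mul_thetaTwo_eighth hτ
  have he := thetaTwo_zero_mul_thetaThree_quarter h2
  rw [show 4 * τ = 2 * (2 * τ) by ring]
  apply mul_right_cancel₀ (right_ne_zero_of_mul
    (thetaTwo_three_eighths_mul_thetaTwo_eighth_ne_zero hτ))
  linear_combination h - Real.pi * thetaThree 0 (2 * τ) * thetaThree (1 / 2) (2 * τ) * he +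
    Real.pi * thetaThree 0 (2 * (2 * τ)) *
      (Real.sqrt 2 * thetaThree 0 (2 * τ) + thetaThree 0 (2 * (2 * τ))) * hp

theorem thetaTwoDeriv_eighth (hτ : 0 < τ.im) :
    thetaTwoDeriv (1 / 8) τ = -Real.pi * thetaTwo (1 / 8) τ * thetaThree 0 (4 * τ) *
      (Real.sqrt 2 * thetaThree 0 (2 * τ) - thetaThree 0 (4 * τ)) := by
  have h2 := im_two_mul_pos hτ
  have h := thetaTwoDeriv_mul_thetaTwo (1 / 8) (3 / 8) hτ
  rw [show (1 / 8 + 3 / 8 : ℂ) = 1 / 2 by norm_num,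
    show (1 / 8 - 3 / 8 : ℂ) = -(1 / 4) by norm_num, thetaTwo_half, thetaThreeDeriv_half,
    thetaThree_neg, thetaTwoDeriv_neg, thetaTwoDeriv_half h2, thetaTwoDeriv_quarter h2] at h
  have hp := thetaTwo_three_eighths_mul_thetaTwo_eighth hτ
  have he := thetaTwo_zero_mul_thetaThree_quarter h2
  rw [show 4 * τ = 2 * (2 * τ) by ring]
  apply mul_right_cancel₀ (left_ne_zero_of_mul
    (thetaTwo_three_eighths_mul_thetaTwo_eighth_ne_zero hτ))
  linear_combination h - Real.pi * thetaThree 0 (2 * τ) * thetaThree (1 / 2) (2 * τ) * he +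
    Real.pi * thetaThree 0 (2 * (2 * τ)) *
      (Real.sqrt 2 * thetaThree 0 (2 * τ) - thetaThree 0 (2 * (2 * τ))) * hp

end Nullwerte

/-! ### Return to theta functions with characteristics. -/

/-- The second characteristic of `theta` is a translation of the first variable. -/
theorem theta_eq_theta_add (ε ε' : ℝ) (ζ τ : ℂ) : theta ε ε' ζ τ = theta ε 0 (ζ + ε' / 2) τ := by
  unfold theta
  simp

theorem hasDerivAt_theta_one_and_eq_thetaTwo (ε' : ℝ) {x : ℂ} (hx : (ε' : ℂ) / 2 = x) {τ : ℂ} (hτ : 0 < τ.im) :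
    HasDerivAt (fun ζ : ℂ => theta 1 ε' ζ τ) (thetaTwoDeriv x τ) 0 ∧
      theta 1 ε' 0 τ = thetaTwo x τ := by
  subst hx
  constructor
  · have h := hasDerivAt_thetaTwo (0 + (ε' : ℂ) / 2) hτ
    rw [zero_add] at h
    have hf : (fun ζ : ℂ => theta 1 ε' ζ τ) = fun ζ => thetaTwo (ζ + ε' / 2) τ :=
      funext fun ζ => theta_eq_theta_add 1 ε' ζ τ
    rw [hf]
    exact HasDerivAt.comp_add_const 0 ((ε' : ℂ) / 2) (by rwa [zero_add])
  · rw [theta_eq_theta_add, zero_add, thetaTwo]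

theorem theorem2 (τ : ℂ) (hτ : 0 < τ.im) :
    HasDerivAt (fun ζ : ℂ => theta 1 (1 / 4) ζ τ)
      (-(Real.pi : ℂ) * theta 1 (1 / 4) 0 τ * theta 0 0 0 (4 * τ) *
        ((Real.sqrt 2 : ℂ) * theta 0 0 0 (2 * τ) - theta 0 0 0 (4 * τ))) 0 ∧
    HasDerivAt (fun ζ : ℂ => theta 1 (3 / 4) ζ τ)
      (-(Real.pi : ℂ) * theta 1 (3 / 4) 0 τ * theta 0 0 0 (4 * τ) *
        ((Real.sqrt 2 : ℂ) * theta 0 0 0 (2 * τ) + theta 0 0 0 (4 * τ))) 0 := by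
  obtain ⟨d₁, e₁⟩ := hasDerivAt_theta_one_and_eq_thetaTwo (1 / 4) (x := 1 / 8) (by push_cast; norm_num) hτ
  obtain ⟨d₃, e₃⟩ := hasDerivAt_theta_one_and_eq_thetaTwo (3 / 4) (x := 3 / 8) (by push_cast; norm_num) hτ
  rw [thetaTwoDeriv_eighth hτ] at d₁
  rw [thetaTwoDeriv_three_eighths hτ] at d₃
  rw [e₁, e₃]
  exact ⟨d₁, d₃⟩
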